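/- Let $\psi:\mathbb{R}^2\to\mathbb{R}$ be a function of class $C^2$ and write $z=x+iy$ for the points of $\mathbb{R}^2=\mathbb{C}$. Suppose that $$-\Delta\psi(z)=|z^2-1|^2e^{\psi(z)}\quad\text{for all } z\in\mathbb{R}^2,\qquad \int_{\mathbb{R}^2}|z^2-1|^2e^{\psi(z)}\,dA=16\pi,$$ where $\Delta=\partial_x^2+\partial_y^2$ and $dA=\frac i2\,dz\wedge d\bar z=dx\,dy$ is Lebesgue measure. Then the complex-valued function $e^{\psi(z)}(z^2-1)$ is integrable on $\mathbb{R}^2$ and $$\int_{\mathbb{R}^2}e^{\psi(z)}(z^2-1)\,dA=-8\pi .$$ -/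

import Mathlib

open MeasureTheory

/-! Write `W = |z² - 1|² e^ψ`, `M = ∫ W = 16π`, `∂ = ∂ₓ - i∂ᵧ`, and let `B` be the conjugate of the
integral sought. The value of `B` comes from a Pohozaev identity with complex multiplier `z`.

The integral of `∂(χ_R z W)` vanishes for a cut-off `χ_R`. Since `∂W = W ∂ψ + 4z conj(z² - 1) e^ψ`
and `z² = (z² - 1) + 1`, letting `R → ∞` gives `2M + lim ∫ χ_R z W ∂ψ + 4(M + B) = 0`. The middle
term is found from `2π ∂ψ(x) = ∫ W(y)/(y - x) dy`: exchanging `x` and `y` in the double integral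
replaces the kernel by half of `(χ_R(x)x - χ_R(y)y)/(y - x)`, which tends boundedly to `-1/2`, so
the limit is `-M²/(4π)`. With `M = 16π` this forces `B = -8π`, which is real (`truncated_pohozaev`,
`tendsto_integral_bump_mul_cauchyTransform`).

The representation of `∂ψ` (`dz_eq_integral`) must exclude an added entire function. Cauchy–Pompeiu
applied to a cut-off times `∂ψ` leaves a remainder of order `R⁻¹` times the weighted mean of `|ψ|`
at scale `R`. The equation bounds the mean of `ψ` below by `-C log R`, and integrability of `e^ψ`
controls its positive part, so the remainder vanishes; no pointwise asymptotics of `ψ` are needed.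
-/

/-- Twice the Wirtinger derivative `∂/∂z`. -/
noncomputable def dz (f : ℂ → ℂ) (z : ℂ) : ℂ :=
  fderiv ℝ f z 1 - Complex.I * fderiv ℝ f z Complex.I

/-- Twice the Wirtinger derivative `∂/∂z̄`. -/
noncomputable def dzbar (f : ℂ → ℂ) (z : ℂ) : ℂ :=
  fderiv ℝ f z 1 + Complex.I * fderiv ℝ f z Complex.I

/-- The radial cut-off `(1 - |z|² / R²)₊ⁿ`. -/
noncomputable def bump (n : ℕ) (R : ℝ) (z : ℂ) : ℝ := (max 0 (1 - ‖z‖ ^ 2 / R ^ 2)) ^ n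

/-! ### Regularity and scaling of the radial cut-offs -/

theorem hasDerivAt_max_zero_pow (n : ℕ) (x : ℝ) :
    HasDerivAt (fun x : ℝ => (max 0 x) ^ (n + 2)) ((n + 2 : ℝ) * (max 0 x) ^ (n + 1)) x := by
  rcases lt_trichotomy x 0 with hx | rfl | hx
  · have : (fun x : ℝ => (max 0 x) ^ (n + 2)) =ᶠ[nhds x] fun _ => 0 := by
      filter_upwards [gt_mem_nhds hx] with y hy
      simp [max_eq_left hy.le]
    rw [max_eq_left hx.le]
    simpa using (hasDerivAt_const x (0 : ℝ)).congr_of_eventuallyEq this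
  · have : (fun x : ℝ => (max 0 x) ^ (n + 2)) =O[nhds 0] fun x => ‖x - 0‖ ^ (n + 2) := by
      refine Asymptotics.IsBigO.of_bound 1 (Filter.Eventually.of_forall fun y => ?_)
      simp only [norm_pow, norm_norm, sub_zero, one_mul]
      gcongr
      simp only [Real.norm_eq_abs]
      rw [abs_of_nonneg (le_max_left 0 y)]
      exact max_le (abs_nonneg y) (le_abs_self y)
    simpa using this.hasFDerivAt (by lia) |>.hasDerivAt
  · have : (fun x : ℝ => (max 0 x) ^ (n + 2)) =ᶠ[nhds x] fun x => x ^ (n + 2) := by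
      filter_upwards [lt_mem_nhds hx] with y hy
      simp [max_eq_right hy.le]
    rw [max_eq_right hx.le]
    simpa using (hasDerivAt_pow (n + 2) x).congr_of_eventuallyEq this

theorem hasFDerivAt_bump (n : ℕ) (R : ℝ) (z : ℂ) :
    HasFDerivAt (bump (n + 2) R)
      (-((n + 2 : ℝ) * bump (n + 1) R z * (2 / R ^ 2)) • innerSL ℝ z) z := by
  have h1 : HasFDerivAt (fun z : ℂ => 1 - ‖z‖ ^ 2 / R ^ 2) (-(2 / R ^ 2) • innerSL ℝ z) z := by
    have := ((hasStrictFDerivAt_norm_sq z).hasFDerivAt.mul_const ((R ^ 2)⁻¹)).const_sub 1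
    refine (this.congr_fderiv ?_)
    ext
    simp [div_eq_mul_inv]
    ring
  have := (hasDerivAt_max_zero_pow n (1 - ‖z‖ ^ 2 / R ^ 2)).comp_hasFDerivAt z h1
  refine this.congr_fderiv ?_
  ext
  simp [bump]
  ring

theorem continuous_bump (n : ℕ) (R : ℝ) : Continuous (bump n R) := by
  unfold bump; fun_prop

/-- Each derivative costs one power of the cut-off; exponent at least 2 leaves a gradient that is
continuous across `‖z‖ = R`. -/
theorem contDiff_bump (n : ℕ) (R : ℝ) : ContDiff ℝ 1 (bump (n + 2) R) := by
  rw [contDiff_one_iff_fderiv]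
  refine ⟨fun z => (hasFDerivAt_bump n R z).differentiableAt, ?_⟩
  have : fderiv ℝ (bump (n + 2) R) =
      fun z => -((n + 2 : ℝ) * bump (n + 1) R z * (2 / R ^ 2)) • innerSL ℝ z :=
    funext fun z => (hasFDerivAt_bump n R z).fderiv
  rw [this]
  have := continuous_bump (n + 1) R
  fun_prop

theorem bump_nonneg (n : ℕ) (R : ℝ) (z : ℂ) : 0 ≤ bump n R z :=
  pow_nonneg (le_max_left _ _) n

theorem bump_le_one (n : ℕ) (R : ℝ) (z : ℂ) : bump n R z ≤ 1 :=
  pow_le_one₀ (le_max_left _ _) (max_le zero_le_one (by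
    have : 0 ≤ ‖z‖ ^ 2 / R ^ 2 := by positivity
    linarith))

theorem bump_eq_zero {n : ℕ} {R : ℝ} (hR : 0 < R) {z : ℂ} (hz : R ≤ ‖z‖) :
    bump (n + 1) R z = 0 := by
  have : 1 ≤ ‖z‖ ^ 2 / R ^ 2 := by
    rw [one_le_div (by positivity)]
    gcongr
  rw [bump, max_eq_left (by linarith)]
  simp

theorem hasCompactSupport_bump (n : ℕ) {R : ℝ} (hR : 0 < R) :
    HasCompactSupport (bump (n + 1) R) := by
  refine HasCompactSupport.of_support_subset_isCompact (isCompact_closedBall (0 : ℂ) R) ?_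
  intro z hz
  by_contra h
  exact hz (bump_eq_zero hR (by simpa using (not_le.1 (by simpa using h)).le))

theorem bump_smul (n : ℕ) {R : ℝ} (hR : R ≠ 0) (z : ℂ) :
    bump n R (R • z) = bump n 1 z := by
  rw [bump, bump, norm_smul, mul_pow, Real.norm_eq_abs, sq_abs]
  congr 3
  field_simp

theorem tendsto_bump (n : ℕ) (z : ℂ) :
    Filter.Tendsto (fun R => bump n R z) Filter.atTop (nhds 1) := by
  have h : Filter.Tendsto (fun R : ℝ => ‖z‖ ^ 2 / R ^ 2) Filter.atTop (nhds 0) :=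
    tendsto_const_nhds.div_atTop (Filter.tendsto_pow_atTop two_ne_zero)
  have h2 := ((h.const_sub 1).max (tendsto_const_nhds (x := (0:ℝ)))).pow n
  simpa [bump, max_comm] using h2

/-! ### Integration by parts and Wirtinger calculus -/

theorem integral_fderiv_apply_eq_zero {E : Type*} [NormedAddCommGroup E] [NormedSpace ℝ E]
    {f : ℂ → E} (hf : ContDiff ℝ 1 f) (hc : HasCompactSupport f) (v : ℂ) :
    ∫ z, fderiv ℝ f z v = 0 := by
  have hi : Integrable (fun z => fderiv ℝ f z v) :=
    ((hf.continuous_fderiv one_ne_zero).clm_apply continuous_const).integrable_of_hasCompactSupport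
      (hc.fderiv_apply ℝ v)
  -- Integration by parts against the constant function 1.
  have := integral_smul_fderiv_eq_neg_fderiv_smul_of_integrable (μ := volume)
    (f := fun _ : ℂ => (1 : ℝ)) (g := f) (v := v) (by simp) (by simpa using hi)
    (by simpa using hf.continuous.integrable_of_hasCompactSupport hc)
    (fun _ _ => differentiableAt_const _) (fun x _ => hf.differentiable one_ne_zero x)
  simpa using this

theorem continuous_dz {f : ℂ → ℂ} (hf : ContDiff ℝ 1 f) : Continuous (dz f) := by
  have := hf.continuous_fderiv one_ne_zero
  unfold dz
  fun_prop

theorem dz_mul {f g : ℂ → ℂ} {z : ℂ} (hf : DifferentiableAt ℝ f z) (hg : DifferentiableAt ℝ g z) :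
    dz (fun z => f z * g z) z = dz f z * g z + f z * dz g z := by
  simp only [dz, fderiv_fun_mul hf hg]
  simp
  ring

theorem dzbar_mul {f g : ℂ → ℂ} {z : ℂ} (hf : DifferentiableAt ℝ f z)
    (hg : DifferentiableAt ℝ g z) :
    dzbar (fun z => f z * g z) z = dzbar f z * g z + f z * dzbar g z := by
  simp only [dzbar, fderiv_fun_mul hf hg]
  simp
  ring

theorem integral_dz_eq_zero {f : ℂ → ℂ} (hf : ContDiff ℝ 1 f) (hc : HasCompactSupport f) :
    ∫ z, dz f z = 0 := by
  have hi (v : ℂ) : Integrable (fun z => fderiv ℝ f z v) :=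
    ((hf.continuous_fderiv one_ne_zero).clm_apply continuous_const).integrable_of_hasCompactSupport
      (hc.fderiv_apply ℝ v)
  simp only [dz]
  rw [integral_sub (hi _) ((hi _).const_mul _), integral_const_mul,
    integral_fderiv_apply_eq_zero hf hc, integral_fderiv_apply_eq_zero hf hc]
  simp

theorem hasFDerivAt_ofReal_bump (n : ℕ) (R : ℝ) (z : ℂ) :
    HasFDerivAt (fun z => (bump (n + 2) R z : ℂ)) (Complex.ofRealCLM ∘L
      (-((n + 2 : ℝ) * bump (n + 1) R z * (2 / R ^ 2)) • innerSL ℝ z)) z :=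
  Complex.ofRealCLM.hasFDerivAt.comp z (hasFDerivAt_bump n R z)

theorem contDiff_ofReal_bump (n : ℕ) (R : ℝ) :
    ContDiff ℝ 1 (fun z => (bump (n + 2) R z : ℂ)) :=
  Complex.ofRealCLM.contDiff.comp (contDiff_bump n R)

theorem dz_bump (n : ℕ) (R : ℝ) (z : ℂ) :
    dz (fun z => (bump (n + 2) R z : ℂ)) z =
      -((n + 2 : ℝ) * bump (n + 1) R z * (2 / R ^ 2) : ℝ) * (starRingEnd ℂ) z := by
  rw [dz, (hasFDerivAt_ofReal_bump n R z).fderiv]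
  apply Complex.ext
  · simp
    ring
  · simp

theorem dzbar_bump (n : ℕ) (R : ℝ) (z : ℂ) :
    dzbar (fun z => (bump (n + 2) R z : ℂ)) z =
      -((n + 2 : ℝ) * bump (n + 1) R z * (2 / R ^ 2) : ℝ) * z := by
  rw [dzbar, (hasFDerivAt_ofReal_bump n R z).fderiv]
  apply Complex.ext
  · simp
    ring
  · simp

/-! ### The Cauchy–Pompeiu formula in polar coordinates -/

theorem integrableOn_polar_of_continuous {g : ℝ × ℝ → ℂ} (hg : Continuous g) (ρ : ℝ)
    (h0 : ∀ p : ℝ × ℝ, ρ < p.1 → g p = 0) :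
    IntegrableOn g (Set.Ioi 0 ×ˢ Set.Ioo (-Real.pi) Real.pi) := by
  have h1 : IntegrableOn g (Set.Icc 0 ρ ×ˢ Set.Icc (-Real.pi) Real.pi) :=
    hg.continuousOn.integrableOn_compact (isCompact_Icc.prod isCompact_Icc)
  refine h1.of_forall_sdiff_eq_zero (measurableSet_Ioi.prod measurableSet_Ioo) ?_
  rintro ⟨r, θ⟩ ⟨⟨hr, hθ⟩, h⟩
  apply h0
  by_contra hle
  exact h ⟨⟨le_of_lt hr, not_lt.1 hle⟩, Set.Ioo_subset_Icc_self hθ⟩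

/-- **Cauchy–Pompeiu formula** at the origin for compactly supported functions. -/
theorem integral_dzbar_div {f : ℂ → ℂ} (hf : ContDiff ℝ 1 f) (hc : HasCompactSupport f) :
    ∫ y, dzbar f y / y = -(2 * Real.pi * f 0) := by
  have hcd := hf.continuous_fderiv one_ne_zero
  obtain ⟨ρ, hρ⟩ := (hc.fderiv ℝ).isCompact.isBounded.subset_closedBall (0 : ℂ)
  obtain ⟨ρ', hρ'⟩ := hc.isCompact.isBounded.subset_closedBall (0 : ℂ)
  let e : ℝ → ℂ := fun θ => Real.cos θ + Real.sin θ * Complex.I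
  have he : ∀ θ, e θ = Complex.exp (θ * Complex.I) := fun θ => by
    simp [e, Complex.exp_mul_I]
  have hne : ∀ θ, ‖e θ‖ = 1 := fun θ => by rw [he, Complex.norm_exp_ofReal_mul_I]
  have hec : Continuous e := by fun_prop
  -- `A = ∂_r f` and `r B = ∂_θ f`. The polar Jacobian cancels the singularity, so the integrand
  -- becomes `A + iB`: the radial integral of `A` is `-f 0`, and the angular integral of `B`
  -- vanishes by periodicity.
  let A : ℝ × ℝ → ℂ := fun p => fderiv ℝ f (p.1 * e p.2) (e p.2)
  let B : ℝ × ℝ → ℂ := fun p => fderiv ℝ f (p.1 * e p.2) (Complex.I * e p.2)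
  have hA : Continuous A := by fun_prop
  have hB : Continuous B := by fun_prop
  have hz : ∀ p : ℝ × ℝ, max ρ 0 < p.1 → fderiv ℝ f (p.1 * e p.2) = 0 := by
    intro p hp
    by_contra h
    have := hρ (subset_tsupport _ (Function.mem_support.2 h))
    simp only [mem_closedBall_zero_iff, norm_mul, hne, mul_one, Complex.norm_real,
      Real.norm_eq_abs] at this
    exact absurd (lt_of_le_of_lt (le_max_left _ _) hp) (not_lt.2 ((le_abs_self _).trans this))
  have hAi := integrableOn_polar_of_continuous hA (max ρ 0) (fun p hp => by simp [A, hz p hp])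
  have hBi := integrableOn_polar_of_continuous hB (max ρ 0) (fun p hp => by simp [B, hz p hp])
  have hderiv : ∀ θ r : ℝ, HasDerivAt (fun r : ℝ => f (r * e θ)) (A (r, θ)) r := by
    intro θ r
    have h1 : HasDerivAt (fun r : ℝ => (r : ℂ) * e θ) (e θ) r := by
      simpa using (Complex.ofRealCLM.hasDerivAt (x := r)).mul_const (e θ)
    exact (hf.differentiable one_ne_zero (r * e θ)).hasFDerivAt.comp_hasDerivAt r h1
  have hderiv' : ∀ θ r : ℝ, HasDerivAt (fun θ : ℝ => f (r * e θ)) (r * B (r, θ)) θ := by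
    intro θ r
    have h0 : HasDerivAt e (Complex.I * e θ) θ := by
      have : e = fun θ : ℝ => Complex.exp (θ * Complex.I) := funext he
      rw [he, this]
      have h2 : HasDerivAt (fun θ : ℝ => (θ : ℂ) * Complex.I) Complex.I θ := by
        simpa using (Complex.ofRealCLM.hasDerivAt (x := θ)).mul_const Complex.I
      simpa [mul_comm] using h2.cexp
    have h1 : HasDerivAt (fun θ : ℝ => (r : ℂ) * e θ) (r * (Complex.I * e θ)) θ :=
      h0.const_mul _
    have h3 := (hf.differentiable one_ne_zero (r * e θ)).hasFDerivAt.comp_hasDerivAt θ h1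
    refine h3.congr_deriv ?_
    rw [← Complex.real_smul, ← Complex.real_smul (z := Complex.I * e θ), map_smul]
    simp only [B, Complex.real_smul]
  have hAint : ∫ p in Set.Ioi 0 ×ˢ Set.Ioo (-Real.pi) Real.pi, A p = -(2 * Real.pi * f 0) := by
    have hAi' := hAi
    rw [IntegrableOn, Measure.volume_eq_prod, ← Measure.prod_restrict] at hAi'
    rw [Measure.volume_eq_prod, ← Measure.prod_restrict, integral_prod_symm _ hAi']
    have : ∀ᵐ θ ∂(volume.restrict (Set.Ioo (-Real.pi) Real.pi)),
        ∫ r in Set.Ioi 0, A (r, θ) = -f 0 := by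
      filter_upwards [hAi'.prod_left_ae] with θ hθ
      have := integral_Ioi_of_hasDerivAt_of_tendsto (a := 0) (f := fun r : ℝ => f (r * e θ))
        (f' := fun r => A (r, θ)) (m := 0) (by have := hf.continuous; fun_prop)
        (fun r _ => hderiv θ r) hθ ?_
      · simpa using this
      · refine tendsto_const_nhds.congr' ?_
        filter_upwards [Filter.eventually_gt_atTop (max ρ' 0)] with r hr
        by_contra h
        have := hρ' (subset_tsupport _ (Function.mem_support.2 (Ne.symm h)))
        simp only [mem_closedBall_zero_iff, norm_mul, hne, mul_one, Complex.norm_real,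
          Real.norm_eq_abs] at this
        exact absurd (lt_of_le_of_lt (le_max_left _ _) hr) (not_lt.2 ((le_abs_self _).trans this))
    rw [integral_congr_ae this]
    simp [Real.pi_pos.le, two_mul]
  have hBint : ∫ p in Set.Ioi 0 ×ˢ Set.Ioo (-Real.pi) Real.pi, B p = 0 := by
    rw [Measure.volume_eq_prod] at hBi ⊢
    rw [setIntegral_prod _ hBi]
    apply integral_eq_zero_of_ae
    filter_upwards [ae_restrict_mem measurableSet_Ioi] with r hr
    have hr' : (r : ℂ) ≠ 0 := by exact_mod_cast (ne_of_gt hr)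
    rw [← integral_Ioc_eq_integral_Ioo,
      ← intervalIntegral.integral_of_le (by linarith [Real.pi_pos])]
    have h := intervalIntegral.integral_eq_sub_of_hasDerivAt (a := -Real.pi) (b := Real.pi)
      (f := fun θ : ℝ => f (r * e θ)) (f' := fun θ => r * B (r, θ)) (fun θ _ => hderiv' θ r)
      (by
        apply Continuous.intervalIntegrable
        fun_prop)
    rw [intervalIntegral.integral_const_mul] at h
    have h2 : e Real.pi = e (-Real.pi) := by simp [e]
    rw [h2, sub_self] at h
    simpa [hr'] using h
  rw [← Complex.integral_comp_polarCoord_symm, polarCoord_target]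
  have hcongr : ∀ p ∈ Set.Ioi (0 : ℝ) ×ˢ Set.Ioo (-Real.pi) Real.pi,
      p.1 • (dzbar f (Complex.polarCoord.symm p) / Complex.polarCoord.symm p) =
        A p + Complex.I * B p := by
    rintro ⟨r, θ⟩ ⟨hr, -⟩
    have hr' : (r : ℂ) ≠ 0 := by exact_mod_cast (ne_of_gt hr)
    have he0 : e θ ≠ 0 := by rw [he]; exact Complex.exp_ne_zero _
    have hp : Complex.polarCoord.symm (r, θ) = r * e θ := by
      rw [Complex.polarCoord_symm_apply]
    have hlin : ∀ a b : ℝ, fderiv ℝ f (r * e θ) (a + b * Complex.I) =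
        a * fderiv ℝ f (r * e θ) 1 + b * fderiv ℝ f (r * e θ) Complex.I := by
      intro a b
      have : (a + b * Complex.I : ℂ) = a • (1 : ℂ) + b • Complex.I := by simp
      rw [this, map_add, map_smul, map_smul]
      simp
    have hIe : Complex.I * e θ = ((-Real.sin θ : ℝ) : ℂ) + (Real.cos θ : ℝ) * Complex.I := by
      simp only [e]
      push_cast
      linear_combination (Complex.sin θ) * Complex.I_sq
    have hcs : (Real.cos θ : ℂ) ^ 2 + (Real.sin θ : ℂ) ^ 2 = 1 := by
      exact_mod_cast Real.cos_sq_add_sin_sq θ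
    rw [hp]
    simp only [A, B, dzbar]
    rw [hIe, hlin, hlin]
    rw [Complex.real_smul]
    field_simp
    generalize fderiv ℝ f (r * e θ) 1 = a
    generalize fderiv ℝ f (r * e θ) Complex.I = b
    simp only [e, Complex.ofReal_neg]
    linear_combination (a + Complex.I * b) * (-hcs) +
      (a * (Real.sin θ : ℂ) ^ 2 - b * Real.cos θ * Real.sin θ) * Complex.I_sq
  rw [setIntegral_congr_fun (measurableSet_Ioi.prod measurableSet_Ioo) hcongr,
    integral_add hAi (hBi.const_mul _), integral_const_mul, hAint, hBint]
  simp

/-! ### Logarithmic growth of weighted means -/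

theorem fderiv_fderiv_apply {u : ℂ → ℝ} (hu : ContDiff ℝ 2 u) (v w z : ℂ) :
    fderiv ℝ (fun z => fderiv ℝ u z v) z w = fderiv ℝ (fderiv ℝ u) z w v := by
  have h : ContDiff ℝ 1 (fderiv ℝ u) := hu.fderiv_right (by norm_num)
  rw [fderiv_clm_apply (h.differentiable one_ne_zero z) (differentiableAt_const v)]
  simp

theorem laplacian_eq_fderiv_fderiv (u : ℂ → ℝ) (z : ℂ) :
    Laplacian.laplacian u z =
      fderiv ℝ (fderiv ℝ u) z 1 1 + fderiv ℝ (fderiv ℝ u) z Complex.I Complex.I := by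
  rw [InnerProductSpace.laplacian_eq_iteratedFDeriv_complexPlane]
  simp [iteratedFDeriv_two_apply]

theorem fderiv_apply_eq_re_im (L : ℂ →L[ℝ] ℝ) (z : ℂ) :
    L z = z.re * L 1 + z.im * L Complex.I := by
  conv_lhs => rw [← Complex.re_add_im z]
  have : (z.re + z.im * Complex.I : ℂ) = z.re • (1 : ℂ) + z.im • Complex.I := by simp
  rw [this, map_add, map_smul, map_smul]
  simp

/-- Since `∇(bump 3 1) = -6 (bump 2 1) z`, this is the divergence theorem for `bump 3 1 z • ∇u(tz)`.
-/
theorem integral_radial_derivative_bump {u W : ℂ → ℝ} (hu : ContDiff ℝ 2 u) (hW : Continuous W)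
    (hΔ : ∀ z, -(Laplacian.laplacian u z) = W z) (t : ℝ) :
    ∫ z, fderiv ℝ u (t • z) z * bump 2 1 z = -(t / 6) * ∫ z, W (t • z) * bump 3 1 z := by
  have h1 : ContDiff ℝ 1 (fderiv ℝ u) := hu.fderiv_right (by norm_num)
  let F : ℂ → ℂ → ℝ := fun v z => fderiv ℝ u (t • z) v * bump 3 1 z
  have hFc (v : ℂ) : ContDiff ℝ 1 (F v) :=
    ((h1.comp (contDiff_const_smul t)).clm_apply contDiff_const).mul (contDiff_bump 1 1)
  have hFs (v : ℂ) : HasCompactSupport (F v) :=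
    (hasCompactSupport_bump 2 one_pos).mul_left
  have hi (v : ℂ) : Integrable (fun z => fderiv ℝ (F v) z v) :=
    (((hFc v).continuous_fderiv one_ne_zero).clm_apply
      continuous_const).integrable_of_hasCompactSupport ((hFs v).fderiv_apply ℝ v)
  have hF (v z : ℂ) : fderiv ℝ (F v) z v =
      t * fderiv ℝ (fderiv ℝ u) (t • z) v v * bump 3 1 z -
        fderiv ℝ u (t • z) v * (6 * bump 2 1 z * inner ℝ z v) := by
    have e1 : HasFDerivAt (fun z => fderiv ℝ u (t • z) v)
        ((fderiv ℝ (fun z => fderiv ℝ u z v) (t • z)) ∘L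
          (t • ContinuousLinearMap.id ℝ ℂ)) z := by
      have : HasFDerivAt (fun z : ℂ => t • z) (t • ContinuousLinearMap.id ℝ ℂ) z :=
        (hasFDerivAt_id z).const_smul t
      exact HasFDerivAt.comp (g := fun z => fderiv ℝ u z v) z
        (((h1.clm_apply contDiff_const).differentiable one_ne_zero (t • z)).hasFDerivAt) this
    have : fderiv ℝ (F v) z = _ := (e1.mul (hasFDerivAt_bump 1 1 z)).fderiv
    rw [this]
    simp [fderiv_fderiv_apply hu]
    ring
  have hsum (z : ℂ) : 6 * (fderiv ℝ u (t • z) z * bump 2 1 z) + t * (W (t • z) * bump 3 1 z) =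
      -(fderiv ℝ (F 1) z 1 + fderiv ℝ (F Complex.I) z Complex.I) := by
    rw [hF, hF, ← hΔ, laplacian_eq_fderiv_fderiv, fderiv_apply_eq_re_im (fderiv ℝ u (t • z)) z]
    simp [Complex.inner]
    ring
  have i1 : Integrable (fun z => fderiv ℝ u (t • z) z * bump 2 1 z) := by
    have := continuous_bump 2 1
    have := h1.continuous
    refine Continuous.integrable_of_hasCompactSupport (by fun_prop)
      (hasCompactSupport_bump 1 one_pos).mul_left
  have i2 : Integrable (fun z => W (t • z) * bump 3 1 z) := by
    have := continuous_bump 3 1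
    refine Continuous.integrable_of_hasCompactSupport (by fun_prop)
      (hasCompactSupport_bump 2 one_pos).mul_left
  have := integral_congr_ae (Filter.Eventually.of_forall hsum) (μ := volume)
  rw [integral_add (i1.const_mul _) (i2.const_mul _), integral_neg, integral_add (hi _) (hi _),
    integral_fderiv_apply_eq_zero (hFc _) (hFs _), integral_fderiv_apply_eq_zero (hFc _) (hFs _),
    integral_const_mul, integral_const_mul] at this
  linarith

theorem hasDerivAt_integral_smul_bump {u : ℂ → ℝ} (hu : ContDiff ℝ 2 u) (t : ℝ) :
    HasDerivAt (fun t : ℝ => ∫ z, u (t • z) * bump 2 1 z)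
      (∫ z, fderiv ℝ u (t • z) z * bump 2 1 z) t := by
  have hb := continuous_bump 2 1
  have hc := hu.continuous
  have h1 : Continuous (fderiv ℝ u) := hu.continuous_fderiv two_ne_zero
  obtain ⟨C, hC⟩ := ((isCompact_closedBall t 1).prod
    (isCompact_closedBall (0 : ℂ) 1)).exists_bound_of_continuousOn
    (f := fun p : ℝ × ℂ => fderiv ℝ u (p.1 • p.2) p.2) (by fun_prop)
  refine (hasDerivAt_integral_of_dominated_loc_of_deriv_le (s := Metric.closedBall t 1)
    (F := fun t z => u (t • z) * bump 2 1 z) (F' := fun t z => fderiv ℝ u (t • z) z * bump 2 1 z)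
    (bound := fun z => C * bump 2 1 z)
    (Metric.closedBall_mem_nhds t one_pos) ?_ ?_ ?_ ?_ ?_ ?_).2
  · exact Filter.Eventually.of_forall fun s => Continuous.aestronglyMeasurable (by fun_prop)
  · exact Continuous.integrable_of_hasCompactSupport (by fun_prop)
      (hasCompactSupport_bump 1 one_pos).mul_left
  · exact Continuous.aestronglyMeasurable (by fun_prop)
  · refine Filter.Eventually.of_forall fun z s hs => ?_
    by_cases hz : 1 ≤ ‖z‖
    · simp [bump_eq_zero one_pos hz]
    · rw [norm_mul, Real.norm_of_nonneg (bump_nonneg 2 1 z)]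
      exact mul_le_mul_of_nonneg_right (hC (s, z) ⟨hs, by simpa using (not_le.1 hz).le⟩)
        (bump_nonneg 2 1 z)
  · exact Continuous.integrable_of_hasCompactSupport (by fun_prop)
      (hasCompactSupport_bump 1 one_pos).mul_left
  · refine Filter.Eventually.of_forall fun z s hs => ?_
    have h : HasDerivAt (fun s : ℝ => s • z) z s := by
      simpa using (hasDerivAt_id s).smul_const z
    exact (((hu.differentiable two_ne_zero (s • z)).hasFDerivAt.comp_hasDerivAt s h)).mul_const _

/-- By the radial identity and a change of variables, the mean at scale `t` has derivative at least
`-M/(6t)`; integrate from 1 to `R`. -/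
theorem integral_smul_bump_lower_bound {u W : ℂ → ℝ} (hu : ContDiff ℝ 2 u) (hW : Continuous W)
    (hW0 : ∀ z, 0 ≤ W z) (hWi : Integrable W)
    (hΔ : ∀ z, -(Laplacian.laplacian u z) = W z) {R : ℝ} (hR : 1 ≤ R) :
    (∫ z, u z * bump 2 1 z) - (∫ z, W z) / 6 * Real.log R ≤ ∫ z, u (R • z) * bump 2 1 z := by
  set M := ∫ z, W z
  let G : ℝ → ℝ := fun t => (∫ z, u (t • z) * bump 2 1 z) + M / 6 * Real.log t
  have hG (t : ℝ) (ht : t ∈ Set.Ici (1 : ℝ)) : HasDerivAt G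
      ((∫ z, fderiv ℝ u (t • z) z * bump 2 1 z) + M / 6 * t⁻¹) t :=
    (hasDerivAt_integral_smul_bump hu t).add
      ((Real.hasDerivAt_log (by linarith [Set.mem_Ici.1 ht])).const_mul _)
  have hmono : MonotoneOn G (Set.Ici 1) := by
    refine monotoneOn_of_deriv_nonneg (convex_Ici 1)
      (fun t ht => (hG t ht).continuousAt.continuousWithinAt)
      (fun t ht => (hG t (interior_subset ht)).differentiableAt.differentiableWithinAt) ?_
    intro t ht
    have ht1 : (1 : ℝ) ≤ t := interior_subset ht
    have ht0 : 0 < t := by linarith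
    rw [(hG t (interior_subset ht)).deriv, integral_radial_derivative_bump hu hW hΔ]
    have hle : ∫ z, W (t • z) * bump 3 1 z ≤ ∫ z, W (t • z) := by
      refine integral_mono_of_nonneg
        (Filter.Eventually.of_forall fun z => mul_nonneg (hW0 _) (bump_nonneg 3 1 z))
        (hWi.comp_smul ht0.ne') (Filter.Eventually.of_forall fun z => ?_)
      exact mul_le_of_le_one_right (hW0 _) (bump_le_one 3 1 z)
    rw [Measure.integral_comp_smul_of_nonneg _ _ _ (hR := ht0.le), Complex.finrank_real_complex,
      smul_eq_mul] at hle
    have : t / 6 * ∫ z, W (t • z) * bump 3 1 z ≤ t / 6 * ((t ^ 2)⁻¹ * M) := by gcongr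
    have e : t / 6 * ((t ^ 2)⁻¹ * M) = M / 6 * t⁻¹ := by field_simp
    linarith
  have := hmono (Set.mem_Ici.2 le_rfl) (Set.mem_Ici.2 hR) hR
  simp only [G, one_smul, Real.log_one] at this
  linarith

/-- From `|s| + s ≤ 2 eˢ`, the mean of `|u|` is at most `2∫ eᵘ` minus the mean of `u`, hence `O(log
R)` by the lower bound. -/
theorem tendsto_inv_mul_integral_abs_bump {u W : ℂ → ℝ} (hu : ContDiff ℝ 2 u) (hW : Continuous W)
    (hW0 : ∀ z, 0 ≤ W z) (hWi : Integrable W)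
    (hΔ : ∀ z, -(Laplacian.laplacian u z) = W z) (he : Integrable fun z => Real.exp (u z)) :
    Filter.Tendsto (fun R : ℝ => R⁻¹ * ∫ z, |u (R • z)| * bump 2 1 z) Filter.atTop (nhds 0) := by
  set M := ∫ z, W z
  set A := ∫ z, u z * bump 2 1 z
  set E := ∫ z, Real.exp (u z)
  have hb := continuous_bump 2 1
  have hc := hu.continuous
  have hle : ∀ R : ℝ, 1 ≤ R →
      ∫ z, |u (R • z)| * bump 2 1 z ≤ 2 * E - A + M / 6 * Real.log R := by
    intro R hR
    have hR0 : 0 < R := by linarith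
    have i1 : Integrable (fun z => |u (R • z)| * bump 2 1 z) :=
      Continuous.integrable_of_hasCompactSupport (by fun_prop)
        (hasCompactSupport_bump 1 one_pos).mul_left
    have i2 : Integrable (fun z => u (R • z) * bump 2 1 z) :=
      Continuous.integrable_of_hasCompactSupport (by fun_prop)
        (hasCompactSupport_bump 1 one_pos).mul_left
    have i3 : Integrable (fun z => Real.exp (u (R • z))) := he.comp_smul hR0.ne'
    have hmono : ∫ z, |u (R • z)| * bump 2 1 z ≤
        ∫ z, (2 * Real.exp (u (R • z)) - u (R • z) * bump 2 1 z) := by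
      refine integral_mono i1 ((i3.const_mul 2).sub i2) fun z => ?_
      have h0 := bump_nonneg 2 1 z
      have h1 := bump_le_one 2 1 z
      have hx : |u (R • z)| + u (R • z) ≤ 2 * Real.exp (u (R • z)) := by
        rcases abs_cases (u (R • z)) with ⟨h, _⟩ | ⟨h, _⟩ <;> rw [h] <;>
          nlinarith [Real.add_one_le_exp (u (R • z)), Real.exp_pos (u (R • z))]
      have hy : 0 ≤ |u (R • z)| + u (R • z) := by linarith [neg_abs_le (u (R • z))]
      have := mul_le_of_le_one_right hy h1
      simp only
      linarith
    rw [integral_sub (i3.const_mul 2) i2, integral_const_mul,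
      Measure.integral_comp_smul_of_nonneg (f := fun z => Real.exp (u z)) _ _ (hR := hR0.le),
      Complex.finrank_real_complex, smul_eq_mul] at hmono
    have hE : 0 ≤ E := integral_nonneg fun z => (Real.exp_pos _).le
    have h2 : (R ^ 2)⁻¹ * E ≤ E :=
      mul_le_of_le_one_left hE (inv_le_one_of_one_le₀ (one_le_pow₀ hR))
    have := integral_smul_bump_lower_bound hu hW hW0 hWi hΔ hR
    linarith
  have hlim : Filter.Tendsto (fun R : ℝ => (2 * E - A) * R⁻¹ + M / 6 * (Real.log R / R))
      Filter.atTop (nhds 0) := by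
    have h1 : Filter.Tendsto (fun R : ℝ => Real.log R / R) Filter.atTop (nhds 0) :=
      Real.isLittleO_log_id_atTop.tendsto_div_nhds_zero
    simpa using (tendsto_inv_atTop_zero.const_mul (2 * E - A)).add (h1.const_mul (M / 6))
  refine tendsto_of_tendsto_of_tendsto_of_le_of_le' tendsto_const_nhds hlim ?_ ?_
  · filter_upwards [Filter.eventually_ge_atTop 1] with R hR
    exact mul_nonneg (by positivity)
      (integral_nonneg fun z => mul_nonneg (abs_nonneg _) (bump_nonneg 2 1 z))
  · filter_upwards [Filter.eventually_ge_atTop 1] with R hR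
    have hR0 : 0 < R := by linarith
    calc R⁻¹ * ∫ z, |u (R • z)| * bump 2 1 z
        ≤ R⁻¹ * (2 * E - A + M / 6 * Real.log R) := by
          have := hle R hR
          gcongr
      _ = _ := by field_simp

/-! ### Local integrability of the Cauchy kernel -/

theorem integrable_indicator_ball_norm_inv :
    Integrable (fun z : ℂ => (Metric.ball (0 : ℂ) 1).indicator (fun z => ‖z‖⁻¹) z) := by
  have h : (fun z : ℂ => (Metric.ball (0 : ℂ) 1).indicator (fun z => ‖z‖⁻¹) z) =
      fun z => (Set.Iio (1 : ℝ)).indicator (fun r => r⁻¹) ‖z‖ := by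
    ext z
    simp [Set.indicator]
  rw [h, integrable_fun_norm_addHaar volume (f := (Set.Iio (1 : ℝ)).indicator (fun r => r⁻¹))]
  have h2 : IntegrableOn (fun _ : ℝ => (1 : ℝ)) (Set.Ioo 0 1) := by simp
  refine (h2.integrable_indicator measurableSet_Ioo).integrableOn.congr_fun ?_ measurableSet_Ioi
  intro r hr
  have hr0 : r ≠ 0 := ne_of_gt hr
  by_cases h1 : r < 1 <;> simp [Set.indicator, h1, Set.mem_Ioi.1 hr, hr0]

/-- Pointwise bound of `F(y) / (y - x)` by an integrable function with mass independent of `x`. -/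
theorem norm_div_le_potential {F : ℂ → ℂ} {x y : ℂ} {C : ℝ} (hC : ‖y - x‖ < 1 → ‖F y‖ ≤ C) :
    ‖F y / (y - x)‖ ≤
      C * (Metric.ball (0 : ℂ) 1).indicator (fun z => ‖z‖⁻¹) (y - x) + ‖F y‖ := by
  rw [norm_div, div_eq_mul_inv]
  by_cases h : ‖y - x‖ < 1
  · rw [Set.indicator_of_mem (by simpa using h)]
    have : ‖F y‖ * ‖y - x‖⁻¹ ≤ C * ‖y - x‖⁻¹ := by
      have := hC h
      gcongr
    linarith [norm_nonneg (F y)]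
  · rw [Set.indicator_of_notMem (by simpa using not_lt.1 h)]
    have := mul_le_of_le_one_right (norm_nonneg (F y)) (inv_le_one_of_one_le₀ (not_lt.1 h))
    linarith

theorem integrable_div_sub {F : ℂ → ℂ} (hF : Continuous F) (hFi : Integrable F) (x : ℂ) :
    Integrable fun y => F y / (y - x) := by
  obtain ⟨C, hC⟩ := (isCompact_closedBall x 1).exists_bound_of_continuousOn hF.continuousOn
  have hk := (integrable_indicator_ball_norm_inv.comp_sub_right x).const_mul C
  refine (hk.add hFi.norm).mono' ?_ (Filter.Eventually.of_forall fun y => ?_)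
  · exact (hF.measurable.div (measurable_id.sub_const x)).aestronglyMeasurable
  · exact norm_div_le_potential fun h => hC y (by simpa [dist_eq_norm] using h.le)

/-! ### The gradient as a Cauchy transform -/

theorem dz_ofReal {u : ℂ → ℝ} {z : ℂ} (hu : DifferentiableAt ℝ u z) :
    dz (fun z => (u z : ℂ)) z = fderiv ℝ u z 1 - Complex.I * fderiv ℝ u z Complex.I := by
  have : HasFDerivAt (fun z => (u z : ℂ)) (Complex.ofRealCLM ∘L fderiv ℝ u z) z :=
    Complex.ofRealCLM.hasFDerivAt.comp z hu.hasFDerivAt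
  rw [dz, this.fderiv]
  simp

theorem dz_ofReal_eq {u : ℂ → ℝ} (hu : Differentiable ℝ u) :
    dz (fun z => (u z : ℂ)) = fun z =>
      ((fderiv ℝ u z 1 : ℝ) : ℂ) - Complex.I * (fderiv ℝ u z Complex.I : ℝ) :=
  funext fun z => dz_ofReal (hu z)

theorem contDiff_dz_ofReal {u : ℂ → ℝ} (hu : ContDiff ℝ 2 u) :
    ContDiff ℝ 1 (dz (fun z => (u z : ℂ))) := by
  rw [dz_ofReal_eq (hu.differentiable two_ne_zero)]
  have h1 : ContDiff ℝ 1 (fderiv ℝ u) := hu.fderiv_right (by norm_num)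
  have h (v : ℂ) : ContDiff ℝ 1 (fun z => ((fderiv ℝ u z v : ℝ) : ℂ)) :=
    Complex.ofRealCLM.contDiff.comp (h1.clm_apply contDiff_const)
  exact (h 1).sub (contDiff_const.mul (h Complex.I))

/-- Mixed second derivatives cancel by symmetry; the normalisation "twice the Wirtinger derivative"
makes the constant 1. -/
theorem dzbar_dz_ofReal {u : ℂ → ℝ} (hu : ContDiff ℝ 2 u) (z : ℂ) :
    dzbar (dz (fun z => (u z : ℂ))) z = (Laplacian.laplacian u z : ℝ) := by
  have h1 : ContDiff ℝ 1 (fderiv ℝ u) := hu.fderiv_right (by norm_num)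
  have h (v : ℂ) : HasFDerivAt (fun z => ((fderiv ℝ u z v : ℝ) : ℂ))
      (Complex.ofRealCLM ∘L fderiv ℝ (fun z => fderiv ℝ u z v) z) z :=
    Complex.ofRealCLM.hasFDerivAt.comp z
      ((h1.clm_apply contDiff_const).differentiable one_ne_zero z).hasFDerivAt
  have hs : fderiv ℝ (fderiv ℝ u) z 1 Complex.I = fderiv ℝ (fderiv ℝ u) z Complex.I 1 :=
    (hu.contDiffAt (x := z)).isSymmSndFDerivAt (by simp) 1 Complex.I
  rw [dz_ofReal_eq (hu.differentiable two_ne_zero), dzbar,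
    ((h 1).fun_sub ((h Complex.I).const_mul Complex.I)).fderiv, laplacian_eq_fderiv_fderiv]
  simp [fderiv_fderiv_apply hu, hs]
  linear_combination (-(fderiv ℝ (fderiv ℝ u) z Complex.I Complex.I : ℂ)) * Complex.I_sq

/-- Moves the derivative onto the cut-off, so that only means of `u`, not of its gradient, have to
be controlled. -/
theorem integral_dz_ofReal_mul_bump {u : ℂ → ℝ} (hu : ContDiff ℝ 2 u) {R : ℝ} (hR : 0 < R) :
    ∫ z, dz (fun z => (u z : ℂ)) z * bump 3 R z =
      ∫ z, ((6 / R ^ 2 * (u z * bump 2 R z) : ℝ) : ℂ) * (starRingEnd ℂ) z := by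
  have hc : ContDiff ℝ 1 (fun z => (u z : ℂ)) :=
    Complex.ofRealCLM.contDiff.comp (hu.of_le (by norm_num))
  have hb := contDiff_ofReal_bump 1 R
  have hbs : HasCompactSupport (fun z => (bump 3 R z : ℂ)) :=
    (hasCompactSupport_bump 2 hR).comp_left (g := ((↑) : ℝ → ℂ)) Complex.ofReal_zero
  have hb2 := continuous_bump 2 R
  have huc := hu.continuous
  have h := integral_dz_eq_zero (hc.mul hb) hbs.mul_left
  have e (z : ℂ) : dz (fun z => (u z : ℂ) * bump (1 + 2) R z) z =
      dz (fun z => (u z : ℂ)) z * bump 3 R z -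
        ((6 / R ^ 2 * (u z * bump 2 R z) : ℝ) : ℂ) * (starRingEnd ℂ) z := by
    rw [dz_mul (hc.differentiable one_ne_zero z) (hb.differentiable one_ne_zero z), dz_bump]
    push_cast
    ring
  have h' : ∫ z, dz (fun z => (u z : ℂ) * bump (1 + 2) R z) z = 0 := h
  simp only [e] at h'
  rw [integral_sub] at h'
  · exact sub_eq_zero.1 h'
  · exact ((contDiff_dz_ofReal hu).continuous.mul hb.continuous).integrable_of_hasCompactSupport
      hbs.mul_left
  · have : HasCompactSupport fun z => ((6 / R ^ 2 * (u z * bump 2 R z) : ℝ) : ℂ) :=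
      ((hasCompactSupport_bump 1 hR).mul_left.mul_left).comp_left (g := ((↑) : ℝ → ℂ))
        Complex.ofReal_zero
    exact Continuous.integrable_of_hasCompactSupport
      ((by fun_prop : Continuous fun z => ((6 / R ^ 2 * (u z * bump 2 R z) : ℝ) : ℂ)).mul
        Complex.continuous_conj) this.mul_right

/-- Rescaling to the unit disc: the area factor `R²` cancels `R⁻²`, and `‖R • z‖ ≤ R` on the support
leaves one power of `R`. -/
theorem norm_integral_conj_bump_le (u : ℂ → ℝ) (hu : Continuous u) {R : ℝ} (hR : 0 < R) :
    ‖∫ z, ((6 / R ^ 2 * (u z * bump 2 R z) : ℝ) : ℂ) * (starRingEnd ℂ) z‖ ≤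
      6 * R * ∫ z, |u (R • z)| * bump 2 1 z := by
  have hb := continuous_bump 2 1
  have hs := Measure.integral_comp_smul_of_nonneg (volume : Measure ℂ)
    (fun z => ((6 / R ^ 2 * (u z * bump 2 R z) : ℝ) : ℂ) * (starRingEnd ℂ) z) R (hR := hR.le)
  rw [Complex.finrank_real_complex] at hs
  have hs' : ∫ z, ((6 / R ^ 2 * (u z * bump 2 R z) : ℝ) : ℂ) * (starRingEnd ℂ) z =
      (R ^ 2) • ∫ z, ((6 / R ^ 2 * (u (R • z) * bump 2 R (R • z)) : ℝ) : ℂ) *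
        (starRingEnd ℂ) (R • z) := by
    rw [hs, smul_smul, mul_inv_cancel₀ (by positivity), one_smul]
  rw [hs', norm_smul, Real.norm_of_nonneg (by positivity)]
  have hle : ‖∫ z, ((6 / R ^ 2 * (u (R • z) * bump 2 R (R • z)) : ℝ) : ℂ) *
        (starRingEnd ℂ) (R • z)‖ ≤ ∫ z, 6 / R * (|u (R • z)| * bump 2 1 z) := by
    refine norm_integral_le_of_norm_le ?_ (Filter.Eventually.of_forall fun z => ?_)
    · exact (Continuous.integrable_of_hasCompactSupport (by fun_prop)
        (hasCompactSupport_bump 1 one_pos).mul_left).const_mul _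
    · rw [bump_smul 2 hR.ne', norm_mul, RCLike.norm_conj, norm_smul, Complex.norm_real, norm_mul,
        norm_mul, Real.norm_of_nonneg (bump_nonneg 2 1 z), Real.norm_of_nonneg hR.le,
        Real.norm_of_nonneg (by positivity), Real.norm_eq_abs]
      by_cases hz : 1 ≤ ‖z‖
      · simp [bump_eq_zero one_pos hz]
      · have h0 := bump_nonneg 2 1 z
        calc 6 / R ^ 2 * (|u (R • z)| * bump 2 1 z) * (R * ‖z‖)
            ≤ 6 / R ^ 2 * (|u (R • z)| * bump 2 1 z) * (R * 1) := by
              gcongr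
              exact (not_le.1 hz).le
          _ = _ := by field_simp
  rw [integral_const_mul] at hle
  calc _ ≤ R ^ 2 * (6 / R * ∫ z, |u (R • z)| * bump 2 1 z) := by gcongr
    _ = _ := by field_simp

/-- Cauchy–Pompeiu for `bump 4 R * dz u`. Differentiating the cut-off yields a factor `y` that
cancels the kernel; a second integration by parts then uses another power, hence the exponent 4. -/
theorem dz_zero_eq_truncated {u W : ℂ → ℝ} (hu : ContDiff ℝ 2 u) (hW : Continuous W)
    (hΔ : ∀ z, -(Laplacian.laplacian u z) = W z) {R : ℝ} (hR : 0 < R) :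
    2 * Real.pi * dz (fun z => (u z : ℂ)) 0 = (∫ y, ((bump 4 R y * W y : ℝ) : ℂ) / y) +
      8 / R ^ 2 * ∫ z, ((6 / R ^ 2 * (u z * bump 2 R z) : ℝ) : ℂ) * (starRingEnd ℂ) z := by
  have hp := contDiff_dz_ofReal hu
  have hb := contDiff_ofReal_bump 2 R
  have hbs (n : ℕ) : HasCompactSupport (fun z => (bump (n + 1) R z : ℂ)) :=
    (hasCompactSupport_bump n hR).comp_left (g := ((↑) : ℝ → ℂ)) Complex.ofReal_zero
  have hb4 := continuous_bump 4 R
  have hb3 := continuous_bump 3 R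
  have h := integral_dzbar_div (hb.mul hp) (hbs 3).mul_right
  have e : ∀ᵐ y : ℂ, dzbar (fun z => (bump (2 + 2) R z : ℂ) * dz (fun z => (u z : ℂ)) z) y / y =
      -(((bump 4 R y * W y : ℝ) : ℂ) / y) -
        8 / R ^ 2 * (dz (fun z => (u z : ℂ)) y * bump 3 R y) := by
    filter_upwards [Measure.ae_ne volume (0 : ℂ)] with y hy
    rw [dzbar_mul (hb.differentiable one_ne_zero y) (hp.differentiable one_ne_zero y), dzbar_bump,
      dzbar_dz_ofReal hu, ← hΔ]
    push_cast
    field_simp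
    ring
  have i1 : Integrable (fun y => ((bump 4 R y * W y : ℝ) : ℂ) / y) := by
    have hc : Continuous (fun y => ((bump 4 R y * W y : ℝ) : ℂ)) := by fun_prop
    have hs : HasCompactSupport (fun y => ((bump 4 R y * W y : ℝ) : ℂ)) :=
      (hasCompactSupport_bump 3 hR).mul_right.comp_left (g := ((↑) : ℝ → ℂ)) Complex.ofReal_zero
    simpa using integrable_div_sub hc (hc.integrable_of_hasCompactSupport hs) 0
  have i2 : Integrable (fun y => dz (fun z => (u z : ℂ)) y * bump 3 R y) :=
    (hp.continuous.mul (by fun_prop)).integrable_of_hasCompactSupport (hbs 2).mul_left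
  have h' : ∫ y, dzbar (fun z => (bump (2 + 2) R z : ℂ) * dz (fun z => (u z : ℂ)) z) y / y =
    -(2 * Real.pi * ((bump (2 + 2) R 0 : ℂ) * dz (fun z => (u z : ℂ)) 0)) := h
  rw [integral_congr_ae e, integral_sub (by exact i1.neg) (i2.const_mul _), integral_neg, integral_const_mul,
    integral_dz_ofReal_mul_bump hu hR, show bump (2 + 2) R 0 = 1 by simp [bump]] at h'
  push_cast at h' ⊢
  linear_combination h'

theorem dz_zero_eq_integral {u W : ℂ → ℝ} (hu : ContDiff ℝ 2 u) (hW : Continuous W)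
    (hW0 : ∀ z, 0 ≤ W z) (hWi : Integrable W)
    (hΔ : ∀ z, -(Laplacian.laplacian u z) = W z) (he : Integrable fun z => Real.exp (u z)) :
    2 * Real.pi * dz (fun z => (u z : ℂ)) 0 = ∫ y, (W y : ℂ) / y := by
  have hWc : Continuous fun y => (W y : ℂ) := by fun_prop
  have hWdiv : Integrable fun y => (W y : ℂ) / y := by
    simpa using integrable_div_sub hWc hWi.ofReal 0
  have h1 : Filter.Tendsto (fun R : ℝ => ∫ y, ((bump 4 R y * W y : ℝ) : ℂ) / y) Filter.atTop
      (nhds (∫ y, (W y : ℂ) / y)) := by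
    refine tendsto_integral_filter_of_dominated_convergence (fun y => ‖(W y : ℂ) / y‖)
      (Filter.Eventually.of_forall fun R => ?_) (Filter.Eventually.of_forall fun R => ?_)
      hWdiv.norm (Filter.Eventually.of_forall fun y => ?_)
    · have := continuous_bump 4 R
      exact ((by fun_prop : Continuous fun y => ((bump 4 R y * W y : ℝ) : ℂ)).measurable.div
        measurable_id).aestronglyMeasurable
    · refine Filter.Eventually.of_forall fun y => ?_
      rw [norm_div, norm_div, Complex.ofReal_mul, norm_mul, Complex.norm_real (bump 4 R y),
        Real.norm_of_nonneg (bump_nonneg 4 R y)]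
      gcongr
      exact mul_le_of_le_one_left (norm_nonneg _) (bump_le_one 4 R y)
    · have := (Complex.continuous_ofReal.tendsto _).comp ((tendsto_bump 4 y).mul_const (W y))
      simpa [Function.comp_def] using this.div_const y
  have h2 : Filter.Tendsto (fun R : ℝ => (8 / R ^ 2 : ℂ) *
      ∫ z, ((6 / R ^ 2 * (u z * bump 2 R z) : ℝ) : ℂ) * (starRingEnd ℂ) z) Filter.atTop
      (nhds 0) := by
    -- The constant is `48 = 8 · 6`: the remainder is at most `(8/R²) · 6R` times the mean of `|u|`.
    have hz := (tendsto_inv_mul_integral_abs_bump hu hW hW0 hWi hΔ he).const_mul 48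
    rw [mul_zero] at hz
    refine squeeze_zero_norm' ?_ hz
    filter_upwards [Filter.eventually_gt_atTop 0] with R hR
    rw [norm_mul]
    have e1 : ‖(8 / R ^ 2 : ℂ)‖ = 8 / R ^ 2 := by simp
    rw [e1]
    calc _ ≤ 8 / R ^ 2 * (6 * R * ∫ z, |u (R • z)| * bump 2 1 z) := by
          have := norm_integral_conj_bump_le u hu.continuous hR
          gcongr
      _ = _ := by
          field_simp
          ring
  have h3 := h1.add h2
  rw [add_zero] at h3
  refine tendsto_nhds_unique (tendsto_const_nhds.congr' ?_) h3
  filter_upwards [Filter.eventually_gt_atTop 0] with R hR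
  exact dz_zero_eq_truncated hu hW hΔ hR

/-- The gradient of a solution of `-Δu = W` with `W` and `exp u` integrable is the
Cauchy transform of `W`. -/
theorem dz_eq_integral {u W : ℂ → ℝ} (hu : ContDiff ℝ 2 u) (hW : Continuous W)
    (hW0 : ∀ z, 0 ≤ W z) (hWi : Integrable W)
    (hΔ : ∀ z, -(Laplacian.laplacian u z) = W z) (he : Integrable fun z => Real.exp (u z))
    (x : ℂ) :
    2 * Real.pi * dz (fun z => (u z : ℂ)) x = ∫ y, (W y : ℂ) / (y - x) := by
  have hf : fderiv ℝ (fun z => u (z + x)) = fun z => fderiv ℝ u (z + x) :=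
    funext fun z => fderiv_comp_add_right x
  have h := dz_zero_eq_integral (u := fun z => u (z + x)) (W := fun z => W (z + x))
    (hu.comp (contDiff_id.add contDiff_const)) (by fun_prop) (fun z => hW0 _)
    (hWi.comp_add_right x) (fun z => by
      rw [← hΔ, laplacian_eq_fderiv_fderiv, laplacian_eq_fderiv_fderiv, hf]
      rw [fderiv_comp_add_right])
    (he.comp_add_right x)
  have hd : dz (fun z => ((u (z + x) : ℝ) : ℂ)) 0 = dz (fun z => (u z : ℂ)) x := by
    simp only [dz]
    rw [fderiv_comp_add_right (f := fun z => (u z : ℂ)) x, zero_add]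
  rw [hd] at h
  rw [h, ← integral_add_right_eq_self (fun y => (W y : ℂ) / (y - x)) x]
  simp

/-! ### Symmetrization of the double integral -/

/-- Uniformity of `K` in `y` is what makes Fubini applicable to the double integral below. -/
theorem exists_integral_norm_div_sub_le {F : ℂ → ℂ} (hF : Continuous F)
    (hFc : HasCompactSupport F) : ∃ K : ℝ, ∀ y, ∫ x, ‖F x / (x - y)‖ ≤ K := by
  have hFi := hF.integrable_of_hasCompactSupport hFc (μ := (volume : Measure ℂ))
  obtain ⟨C, hC⟩ := hF.bounded_above_of_compact_support hFc
  let k := fun z : ℂ => (Metric.ball (0 : ℂ) 1).indicator (fun z => ‖z‖⁻¹) z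
  have hk : Integrable k := integrable_indicator_ball_norm_inv
  refine ⟨C * (∫ z, k z) + ∫ x, ‖F x‖, fun y => ?_⟩
  have i1 : Integrable fun x => C * k (x - y) := (hk.comp_sub_right y).const_mul C
  calc ∫ x, ‖F x / (x - y)‖ ≤ ∫ x, (C * k (x - y) + ‖F x‖) :=
        integral_mono (integrable_div_sub hF hFi y).norm (i1.add hFi.norm) fun x =>
          norm_div_le_potential (F := F) fun _ => hC x
    _ = _ := by
      rw [integral_add i1 hFi.norm, integral_const_mul, integral_sub_right_eq_self k y]

theorem integrable_mul_div_sub_prod {F : ℂ → ℂ} {W : ℂ → ℝ} (hF : Continuous F)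
    (hFc : HasCompactSupport F) (hW : Continuous W) (hWi : Integrable W) :
    Integrable (fun q : ℂ × ℂ => F q.1 * W q.2 / (q.2 - q.1)) (volume.prod volume) := by
  have hFi := hF.integrable_of_hasCompactSupport hFc (μ := (volume : Measure ℂ))
  obtain ⟨K, hK⟩ := exists_integral_norm_div_sub_le hF hFc
  have hm : Measurable (fun q : ℂ × ℂ => F q.1 * W q.2 / (q.2 - q.1)) := by
    have h1 := hF.measurable
    have h2 := hW.measurable
    fun_prop
  have hpt (x y : ℂ) : F x * W y / (y - x) = -(W y : ℂ) * (F x / (x - y)) := by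
    rw [← neg_sub x y, div_neg]
    ring
  have hnorm (x y : ℂ) : ‖F x * W y / (y - x)‖ = ‖W y‖ * ‖F x / (x - y)‖ := by
    rw [hpt, norm_mul, norm_neg, Complex.norm_real]
  rw [integrable_prod_iff' hm.aestronglyMeasurable]
  refine ⟨Filter.Eventually.of_forall fun y => ?_, ?_⟩
  · simp only [hpt]
    exact (integrable_div_sub hF hFi y).const_mul _
  · refine (hWi.norm.mul_const K).mono'
      hm.norm.aestronglyMeasurable.prod_swap.integral_prod_right'
      (Filter.Eventually.of_forall fun y => ?_)
    rw [Real.norm_of_nonneg (integral_nonneg fun _ => norm_nonneg _)]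
    simp only [hnorm]
    rw [integral_const_mul]
    exact mul_le_mul_of_nonneg_left (hK y) (norm_nonneg _)

/-- Symmetrization of the Cauchy kernel. -/
theorem two_mul_integral_mul_cauchyTransform {X : ℂ → ℂ} {W : ℂ → ℝ} (hX : Continuous X)
    (hXc : HasCompactSupport X) (hW : Continuous W) (hWi : Integrable W) :
    2 * ∫ x, X x * W x * ∫ y, (W y : ℂ) / (y - x) =
      ∫ q : ℂ × ℂ, (X q.1 - X q.2) / (q.2 - q.1) * (W q.1 * W q.2) ∂(volume.prod volume) := by
  have hi : Integrable (fun q : ℂ × ℂ => X q.1 * W q.1 * W q.2 / (q.2 - q.1))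
      (volume.prod volume) :=
    integrable_mul_div_sub_prod (F := fun x => X x * W x) (by fun_prop) hXc.mul_right hW hWi
  have hi' : Integrable (fun q : ℂ × ℂ => X q.2 * W q.2 * W q.1 / (q.1 - q.2))
      (volume.prod volume) := hi.swap
  have h1 : ∫ x, X x * W x * ∫ y, (W y : ℂ) / (y - x) =
      ∫ q : ℂ × ℂ, X q.1 * W q.1 * W q.2 / (q.2 - q.1) ∂(volume.prod volume) := by
    rw [integral_prod _ hi]
    refine integral_congr_ae (Filter.Eventually.of_forall fun x => ?_)
    simp only
    rw [← integral_const_mul]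
    simp only [mul_div_assoc]
  have h2 : ∫ q : ℂ × ℂ, X q.2 * W q.2 * W q.1 / (q.1 - q.2) ∂(volume.prod volume) =
      ∫ q : ℂ × ℂ, X q.1 * W q.1 * W q.2 / (q.2 - q.1) ∂(volume.prod volume) :=
    integral_prod_swap (fun q : ℂ × ℂ => X q.1 * W q.1 * W q.2 / (q.2 - q.1))
  rw [two_mul, h1]
  conv_lhs => enter [2]; rw [← h2]
  rw [← integral_add hi hi']
  refine integral_congr_ae (Filter.Eventually.of_forall fun q => ?_)
  simp only
  rw [← neg_sub q.2 q.1, div_neg]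
  ring

/-- The field at scale `R` is `R X(z/R)` with `X` the compactly supported C¹ field at scale 1, and
this dilation preserves Lipschitz constants. The uniform `L` provides the dominating function for
the symmetrized kernel. -/
theorem exists_lipschitz_bump_mul_id :
    ∃ L : ℝ, ∀ R : ℝ, 0 < R → ∀ x y : ℂ,
      ‖(bump 2 R x : ℂ) * x - bump 2 R y * y‖ ≤ L * ‖y - x‖ := by
  have hc : ContDiff ℝ 1 (fun z : ℂ => (bump 2 1 z : ℂ) * z) :=
    (contDiff_ofReal_bump 0 1).mul contDiff_id
  have hs : HasCompactSupport (fun z : ℂ => (bump 2 1 z : ℂ) * z) :=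
    ((hasCompactSupport_bump 1 one_pos).comp_left (g := ((↑) : ℝ → ℂ))
      Complex.ofReal_zero).mul_right
  obtain ⟨L, hL⟩ := hc.lipschitzWith_of_hasCompactSupport hs one_ne_zero
  refine ⟨L, fun R hR x y => ?_⟩
  have hscale (x : ℂ) : (bump 2 R x : ℂ) * x =
      R • ((bump 2 1 (R⁻¹ • x) : ℂ) * (R⁻¹ • x)) := by
    rw [← bump_smul 2 hR.ne' (R⁻¹ • x), smul_inv_smul₀ hR.ne', mul_smul_comm,
      smul_inv_smul₀ hR.ne']
  rw [hscale x, hscale y, ← smul_sub, norm_smul, Real.norm_of_nonneg hR.le]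
  have := hL.dist_le_mul (R⁻¹ • x) (R⁻¹ • y)
  rw [dist_eq_norm, dist_eq_norm, ← smul_sub, norm_smul, norm_inv, Real.norm_of_nonneg hR.le,
    norm_sub_rev x y] at this
  calc _ ≤ R * (L * (R⁻¹ * ‖y - x‖)) := by gcongr
    _ = _ := by field_simp

theorem tendsto_integral_bump_mul_cauchyTransform {W : ℂ → ℝ} (hW : Continuous W)
    (hWi : Integrable W) :
    Filter.Tendsto (fun R : ℝ => 2 * ∫ x, (bump 2 R x * x) * W x * ∫ y, (W y : ℂ) / (y - x))
      Filter.atTop (nhds (-((∫ x, W x : ℝ) : ℂ) ^ 2)) := by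
  obtain ⟨L, hL⟩ := exists_lipschitz_bump_mul_id
  have hWp : Integrable (fun q : ℂ × ℂ => (W q.1 * W q.2 : ℂ)) (volume.prod volume) :=
    hWi.ofReal.mul_prod hWi.ofReal
  -- On the diagonal the quotient takes the default value 0 instead of tending to `-1`, so this null
  -- set is removed.
  have hdiag : ∀ᵐ q : ℂ × ℂ ∂(volume.prod volume), q ∈ {q : ℂ × ℂ | q.2 - q.1 ≠ 0} := by
    rw [Measure.ae_prod_mem_iff_ae_ae_mem]
    · refine Filter.Eventually.of_forall fun x => ?_
      filter_upwards [Measure.ae_ne volume x] with y hy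
      exact sub_ne_zero.2 hy
    · exact (isClosed_eq (continuous_snd.sub continuous_fst)
        continuous_const).measurableSet.compl
  have hlim : Filter.Tendsto (fun R : ℝ => ∫ q : ℂ × ℂ,
      ((bump 2 R q.1 : ℂ) * q.1 - bump 2 R q.2 * q.2) / (q.2 - q.1) * (W q.1 * W q.2)
        ∂(volume.prod volume)) Filter.atTop
      (nhds (∫ q : ℂ × ℂ, -1 * (W q.1 * W q.2 : ℂ) ∂(volume.prod volume))) := by
    refine tendsto_integral_filter_of_dominated_convergence
      (fun q => L * ‖(W q.1 * W q.2 : ℂ)‖) (Filter.Eventually.of_forall fun R => ?_) ?_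
      (hWp.norm.const_mul L) ?_
    · have h1 := (continuous_bump 2 R).measurable
      have h2 := hW.measurable
      exact Measurable.aestronglyMeasurable (by fun_prop)
    · filter_upwards [Filter.eventually_gt_atTop 0] with R hR
      filter_upwards [hdiag] with q hq
      rw [norm_mul]
      gcongr
      rw [norm_div, div_le_iff₀ (norm_pos_iff.2 hq)]
      exact hL R hR q.1 q.2
    · filter_upwards [hdiag] with q hq
      have hb (z : ℂ) : Filter.Tendsto (fun R : ℝ => (bump 2 R z : ℂ) * z) Filter.atTop
          (nhds z) := by
        simpa [Function.comp_def] using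
          ((Complex.continuous_ofReal.tendsto _).comp (tendsto_bump 2 z)).mul_const z
      have h := ((((hb q.1).sub (hb q.2)).div_const (q.2 - q.1)).mul_const (W q.1 * W q.2 : ℂ))
      convert h using 3
      rw [← neg_sub q.2 q.1, neg_div, div_self hq]
  rw [integral_const_mul, integral_prod_mul (fun x => (W x : ℂ)) (fun x => (W x : ℂ)),
    integral_complex_ofReal] at hlim
  have e : -1 * (((∫ x, W x : ℝ) : ℂ) * ((∫ x, W x : ℝ) : ℂ)) = -((∫ x, W x : ℝ) : ℂ) ^ 2 := by
    ring
  rw [e] at hlim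
  refine hlim.congr' ?_
  filter_upwards [Filter.eventually_gt_atTop 0] with R hR
  have hb := continuous_bump 2 R
  exact (two_mul_integral_mul_cauchyTransform (X := fun x => (bump 2 R x : ℂ) * x) (by fun_prop)
    ((hasCompactSupport_bump 1 hR).comp_left (g := ((↑) : ℝ → ℂ))
      Complex.ofReal_zero).mul_right hW hWi).symm

/-! ### The weighted Pohozaev identity and its limits -/

theorem dz_of_hasDerivAt {f : ℂ → ℂ} {f' z : ℂ} (h : HasDerivAt f f' z) : dz f z = 2 * f' := by
  rw [dz, h.complexToReal_fderiv.fderiv]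
  simp
  linear_combination (-f') * Complex.I_sq

theorem dz_conj_of_hasDerivAt {f : ℂ → ℂ} {f' z : ℂ} (h : HasDerivAt f f' z) :
    dz (fun z => (starRingEnd ℂ) (f z)) z = 0 := by
  have : HasFDerivAt (fun z => (starRingEnd ℂ) (f z))
      ((Complex.conjCLE : ℂ →L[ℝ] ℂ) ∘L (f' • (1 : ℂ →L[ℝ] ℂ))) z :=
    (Complex.conjCLE : ℂ →L[ℝ] ℂ).hasFDerivAt.comp z h.complexToReal_fderiv
  rw [dz, this.fderiv]
  simp
  linear_combination (starRingEnd ℂ f') * Complex.I_sq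

theorem dz_exp {u : ℂ → ℝ} {z : ℂ} (hu : DifferentiableAt ℝ u z) :
    dz (fun z => (Real.exp (u z) : ℂ)) z = Real.exp (u z) * dz (fun z => (u z : ℂ)) z := by
  rw [dz_ofReal hu, dz_ofReal hu.exp, fderiv_exp hu]
  simp
  ring

theorem dz_bump_mul_id (R : ℝ) (z : ℂ) :
    dz (fun z => (bump 2 R z : ℂ) * z) z =
      ((2 * bump 2 R z - 4 * (bump 1 R z * (‖z‖ ^ 2 / R ^ 2)) : ℝ) : ℂ) := by
  rw [dz_mul ((contDiff_ofReal_bump 0 R).differentiable one_ne_zero z) differentiableAt_fun_id,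
    dz_of_hasDerivAt (hasDerivAt_id' z), dz_bump 0 R z]
  have := Complex.mul_conj' z
  push_cast
  linear_combination (-(4 * (bump 1 R z : ℂ) / R ^ 2)) * this

theorem bump_one_mul_le {R : ℝ} (hR : 0 < R) (z : ℂ) : bump 1 R z * (‖z‖ ^ 2 / R ^ 2) ≤ 1 := by
  by_cases hz : R ≤ ‖z‖
  · simp [bump_eq_zero (n := 0) hR hz]
  · refine mul_le_one₀ (bump_le_one 1 R z) (by positivity) ?_
    rw [div_le_one (by positivity)]
    have := (not_le.1 hz).le
    gcongr

theorem tendsto_integral_dz_bump_mul_id {W : ℂ → ℝ} (hWi : Integrable W) :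
    Filter.Tendsto (fun R : ℝ => ∫ z, dz (fun z => (bump 2 R z : ℂ) * z) z * W z) Filter.atTop
      (nhds (2 * ((∫ x, W x : ℝ) : ℂ))) := by
  rw [← integral_complex_ofReal, ← integral_const_mul]
  refine tendsto_integral_filter_of_dominated_convergence (fun z => 4 * ‖(W z : ℂ)‖)
    (Filter.Eventually.of_forall fun R => ?_) ?_ (hWi.ofReal.norm.const_mul 4)
    (Filter.Eventually.of_forall fun z => ?_)
  · exact (continuous_dz ((contDiff_ofReal_bump 0 R).mul contDiff_id)).aestronglyMeasurable.mul
      hWi.ofReal.aestronglyMeasurable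
  · filter_upwards [Filter.eventually_gt_atTop 0] with R hR
    refine Filter.Eventually.of_forall fun z => ?_
    rw [norm_mul, dz_bump_mul_id, Complex.norm_real]
    gcongr
    have h1 := bump_nonneg 2 R z
    have h2 := bump_le_one 2 R z
    have h3 := bump_one_mul_le hR z
    have h4 : 0 ≤ bump 1 R z * (‖z‖ ^ 2 / R ^ 2) := mul_nonneg (bump_nonneg 1 R z) (by positivity)
    rw [Real.norm_eq_abs, abs_le]
    constructor <;> linarith
  · simp only [dz_bump_mul_id]
    have h : Filter.Tendsto (fun R : ℝ => ‖z‖ ^ 2 / R ^ 2) Filter.atTop (nhds 0) :=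
      tendsto_const_nhds.div_atTop (Filter.tendsto_pow_atTop two_ne_zero)
    have h1 := ((tendsto_bump 2 z).const_mul 2).sub
      (((tendsto_bump 1 z).mul h).const_mul 4)
    simpa [Function.comp_def] using
      ((Complex.continuous_ofReal.tendsto _).comp h1).mul_const (W z : ℂ)

theorem tendsto_integral_bump_mul {f : ℂ → ℂ} (hf : Integrable f) :
    Filter.Tendsto (fun R : ℝ => ∫ z, (bump 2 R z : ℂ) * f z) Filter.atTop
      (nhds (∫ z, f z)) := by
  refine tendsto_integral_filter_of_dominated_convergence (fun z => ‖f z‖)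
    (Filter.Eventually.of_forall fun R => ?_)
    (Filter.Eventually.of_forall fun R => Filter.Eventually.of_forall fun z => ?_) hf.norm
    (Filter.Eventually.of_forall fun z => ?_)
  · exact (Complex.continuous_ofReal.comp (continuous_bump 2 R)).aestronglyMeasurable.mul
      hf.aestronglyMeasurable
  · rw [norm_mul, Complex.norm_real, Real.norm_of_nonneg (bump_nonneg 2 R z)]
    exact mul_le_of_le_one_left (norm_nonneg _) (bump_le_one 2 R z)
  · simpa [Function.comp_def] using
      ((Complex.continuous_ofReal.tendsto _).comp (tendsto_bump 2 z)).mul_const (f z)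

/-- The weight is at least 1 outside the disc of radius 2, and `exp ψ` is continuous on that disc.
-/
theorem integrable_exp_of_integrable_weighted {ψ : ℂ → ℝ} (hψ : Continuous ψ)
    (hi : Integrable fun z : ℂ => ‖z ^ 2 - 1‖ ^ 2 * Real.exp (ψ z)) :
    Integrable fun z => Real.exp (ψ z) := by
  have hc : Continuous fun z => Real.exp (ψ z) := by fun_prop
  rw [← integrableOn_univ, ← Set.union_compl_self (Metric.closedBall (0 : ℂ) 2)]
  refine (hc.continuousOn.integrableOn_compact (isCompact_closedBall _ _)).union ?_
  refine hi.integrableOn.mono' hc.aestronglyMeasurable ?_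
  filter_upwards [ae_restrict_mem Metric.isClosed_closedBall.measurableSet.compl] with z hz
  have hz2 : 2 < ‖z‖ := by simpa using hz
  have h1 : 1 ≤ ‖z ^ 2 - 1‖ := by
    have := norm_sub_norm_le (z ^ 2) 1
    rw [norm_pow, norm_one] at this
    nlinarith
  rw [Real.norm_of_nonneg (Real.exp_pos _).le]
  exact le_mul_of_one_le_left (Real.exp_pos _).le (one_le_pow₀ h1)

theorem integrable_exp_mul_of_integrable_weighted {ψ : ℂ → ℝ} (hψ : Continuous ψ)
    (hi : Integrable fun z : ℂ => ‖z ^ 2 - 1‖ ^ 2 * Real.exp (ψ z)) :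
    Integrable fun z : ℂ => (Real.exp (ψ z) : ℂ) * (z ^ 2 - 1) := by
  refine (hi.add (integrable_exp_of_integrable_weighted hψ hi)).mono'
    (Continuous.aestronglyMeasurable (by fun_prop)) (Filter.Eventually.of_forall fun z => ?_)
  rw [norm_mul, Complex.norm_real, Real.norm_of_nonneg (Real.exp_pos _).le]
  simp only [Pi.add_apply]
  nlinarith [sq_nonneg (‖z ^ 2 - 1‖ - 1), Real.exp_pos (ψ z),
    mul_nonneg (Real.exp_pos (ψ z)).le (sq_nonneg (‖z ^ 2 - 1‖ - 1)),
    mul_nonneg (Real.exp_pos (ψ z)).le (sq_nonneg (‖z ^ 2 - 1‖))]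

theorem ofReal_weighted_exp (ψ : ℂ → ℝ) (z : ℂ) :
    ((‖z ^ 2 - 1‖ ^ 2 * Real.exp (ψ z) : ℝ) : ℂ) =
      (z ^ 2 - 1) * (starRingEnd ℂ) (z ^ 2 - 1) * Real.exp (ψ z) := by
  rw [Complex.mul_conj']
  push_cast
  ring

/-- In `W = (z² - 1) conj(z² - 1) e^ψ` the antiholomorphic factor is killed by `∂`, so the weight
contributes only `2 · 2z` times the other two factors. -/
theorem dz_weighted_exp {ψ : ℂ → ℝ} (hψ : Differentiable ℝ ψ) (z : ℂ) :
    dz (fun z => ((‖z ^ 2 - 1‖ ^ 2 * Real.exp (ψ z) : ℝ) : ℂ)) z =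
      ((‖z ^ 2 - 1‖ ^ 2 * Real.exp (ψ z) : ℝ) : ℂ) * dz (fun z => (ψ z : ℂ)) z +
        4 * z * ((starRingEnd ℂ) (z ^ 2 - 1) * Real.exp (ψ z)) := by
  have hd : HasDerivAt (fun z : ℂ => z ^ 2 - 1) (2 * z) z := by
    simpa using (hasDerivAt_pow 2 z).sub_const 1
  have d1 : DifferentiableAt ℝ (fun z : ℂ => z ^ 2 - 1) z := by fun_prop
  have d2 : DifferentiableAt ℝ (fun z : ℂ => (starRingEnd ℂ) (z ^ 2 - 1)) z :=
    (Complex.conjCLE : ℂ →L[ℝ] ℂ).differentiableAt.comp z d1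
  have d3 : DifferentiableAt ℝ (fun z : ℂ => (Real.exp (ψ z) : ℂ)) z :=
    Complex.ofRealCLM.differentiableAt.comp z (hψ z).exp
  have d12 : DifferentiableAt ℝ
    (fun z : ℂ => (z ^ 2 - 1) * (starRingEnd ℂ) (z ^ 2 - 1)) z := d1.mul d2
  simp only [ofReal_weighted_exp]
  rw [dz_mul d12 d3, dz_mul d1 d2, dz_of_hasDerivAt hd, dz_conj_of_hasDerivAt hd,
    dz_exp (hψ z)]
  ring

theorem contDiff_weighted_exp {ψ : ℂ → ℝ} (hψ : ContDiff ℝ 2 ψ) :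
    ContDiff ℝ 1 (fun z => ((‖z ^ 2 - 1‖ ^ 2 * Real.exp (ψ z) : ℝ) : ℂ)) := by
  have h : ContDiff ℝ 1 (fun z : ℂ => ‖z ^ 2 - 1‖ ^ 2 * Real.exp (ψ z)) := by
    have h1 : ContDiff ℝ 1 (fun z : ℂ => z ^ 2 - 1) := by fun_prop
    exact (h1.norm_sq ℝ).mul (hψ.of_le (by norm_num)).exp
  exact Complex.ofRealCLM.contDiff.comp h

/-- Pohozaev identity for the truncated dilation field. -/
theorem truncated_pohozaev {ψ : ℂ → ℝ} (hψ : ContDiff ℝ 2 ψ) {R : ℝ} (hR : 0 < R) :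
    (∫ z, dz (fun z => (bump 2 R z : ℂ) * z) z * (‖z ^ 2 - 1‖ ^ 2 * Real.exp (ψ z) : ℝ)) +
      (∫ z, (bump 2 R z : ℂ) * z * (‖z ^ 2 - 1‖ ^ 2 * Real.exp (ψ z) : ℝ) *
        dz (fun z => (ψ z : ℂ)) z) +
      (∫ z, (bump 2 R z : ℂ) *
        (4 * z ^ 2 * ((starRingEnd ℂ) (z ^ 2 - 1) * Real.exp (ψ z)))) = 0 := by
  have hW := contDiff_weighted_exp hψ
  have hX : ContDiff ℝ 1 (fun z : ℂ => (bump 2 R z : ℂ) * z) :=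
    (contDiff_ofReal_bump 0 R).mul contDiff_id
  have hb : HasCompactSupport (fun z : ℂ => (bump 2 R z : ℂ)) :=
    (hasCompactSupport_bump 1 hR).comp_left (g := ((↑) : ℝ → ℂ)) Complex.ofReal_zero
  have hXs : HasCompactSupport (fun z : ℂ => (bump 2 R z : ℂ) * z) := hb.mul_right
  have hbc := continuous_bump 2 R
  have hψc := hψ.continuous
  have h := integral_dz_eq_zero (hX.mul hW) hXs.mul_right
  have hDs : HasCompactSupport (dz fun z => (bump 2 R z : ℂ) * z) := by
    refine hXs.mono' fun z hz => ?_
    by_contra hn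
    refine hz ?_
    have : fderiv ℝ (fun z => (bump 2 R z : ℂ) * z) z = 0 := by
      by_contra h0
      exact hn (support_fderiv_subset ℝ h0)
    simp [dz, this]
  have i1 : Integrable fun z => dz (fun z => (bump 2 R z : ℂ) * z) z *
      (‖z ^ 2 - 1‖ ^ 2 * Real.exp (ψ z) : ℝ) :=
    ((continuous_dz hX).mul hW.continuous).integrable_of_hasCompactSupport hDs.mul_right
  have i2 : Integrable fun z => (bump 2 R z : ℂ) * z *
      (‖z ^ 2 - 1‖ ^ 2 * Real.exp (ψ z) : ℝ) * dz (fun z => (ψ z : ℂ)) z := ((hX.continuous.mul hW.continuous).mul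
    (contDiff_dz_ofReal hψ).continuous).integrable_of_hasCompactSupport
      hXs.mul_right.mul_right
  have i3 : Integrable fun z => (bump 2 R z : ℂ) *
      (4 * z ^ 2 * ((starRingEnd ℂ) (z ^ 2 - 1) * Real.exp (ψ z))) := by
    have hcc : Continuous (fun z : ℂ => (starRingEnd ℂ) (z ^ 2 - 1)) :=
      Complex.continuous_conj.comp (by fun_prop)
    exact Continuous.integrable_of_hasCompactSupport (by fun_prop) hb.mul_right
  rw [← integral_add i1 i2, ← integral_add (by exact i1.add i2) i3, ← h]
  refine integral_congr_ae (Filter.Eventually.of_forall fun z => ?_)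
  simp only
  change _ = dz (fun z => (fun z => (bump 2 R z : ℂ) * z) z *
    (fun z => ((‖z ^ 2 - 1‖ ^ 2 * Real.exp (ψ z) : ℝ) : ℂ)) z) z
  rw [dz_mul (hX.differentiable one_ne_zero z) (hW.differentiable one_ne_zero z),
    dz_weighted_exp (hψ.differentiable two_ne_zero)]
  ring

/-! ### Passage to the limit and evaluation -/

theorem lemmaA2 (ψ : ℂ → ℝ) (hψ : ContDiff ℝ 2 ψ)
    (heq : ∀ z : ℂ, -(Laplacian.laplacian ψ z) = ‖z ^ 2 - 1‖ ^ 2 * Real.exp (ψ z))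
    (hmass : ∫ z : ℂ, ‖z ^ 2 - 1‖ ^ 2 * Real.exp (ψ z) = 16 * Real.pi) :
    Integrable (fun z : ℂ => (Real.exp (ψ z) : ℂ) * (z ^ 2 - 1)) ∧
      ∫ z : ℂ, (Real.exp (ψ z) : ℂ) * (z ^ 2 - 1) = -(8 * (Real.pi : ℂ)) := by
  have hψc := hψ.continuous
  have hWi : Integrable fun z : ℂ => ‖z ^ 2 - 1‖ ^ 2 * Real.exp (ψ z) := by
    -- A non-integrable function has integral 0 by convention, contradicting the mass `16π`.
    by_contra h
    rw [integral_undef h] at hmass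
    linarith [Real.pi_pos]
  have hWc : Continuous fun z : ℂ => ‖z ^ 2 - 1‖ ^ 2 * Real.exp (ψ z) := by fun_prop
  have he := integrable_exp_of_integrable_weighted hψc hWi
  have hI := integrable_exp_mul_of_integrable_weighted hψc hWi
  refine ⟨hI, ?_⟩
  have hconj : ∀ z : ℂ, (starRingEnd ℂ) (z ^ 2 - 1) * (Real.exp (ψ z) : ℂ) =
      (starRingEnd ℂ) ((Real.exp (ψ z) : ℂ) * (z ^ 2 - 1)) := fun z => by
    rw [map_mul, Complex.conj_ofReal, mul_comm]
  have hIc : Integrable fun z : ℂ => (starRingEnd ℂ) (z ^ 2 - 1) * (Real.exp (ψ z) : ℂ) := by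
    simp only [hconj]
    exact (Complex.conjCLE : ℂ →L[ℝ] ℂ).integrable_comp hI
  have hWic : Integrable fun z : ℂ => ((‖z ^ 2 - 1‖ ^ 2 * Real.exp (ψ z) : ℝ) : ℂ) := hWi.ofReal
  set B := ∫ z : ℂ, (starRingEnd ℂ) (z ^ 2 - 1) * (Real.exp (ψ z) : ℂ) with hB
  have hsplit : ∀ z : ℂ, 4 * z ^ 2 * ((starRingEnd ℂ) (z ^ 2 - 1) * (Real.exp (ψ z) : ℂ)) =
      4 * (((‖z ^ 2 - 1‖ ^ 2 * Real.exp (ψ z) : ℝ) : ℂ) +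
        (starRingEnd ℂ) (z ^ 2 - 1) * (Real.exp (ψ z) : ℂ)) := fun z => by
    rw [ofReal_weighted_exp]
    ring
  have h3 := tendsto_integral_bump_mul ((hWic.add hIc).const_mul 4)
  have h1 := tendsto_integral_dz_bump_mul_id hWi
  -- `(4π)⁻¹` combines `(2π)⁻¹` from the representation of `∂ψ` with the factor 2 introduced by
  -- symmetrization.
  have h2 := (tendsto_integral_bump_mul_cauchyTransform hWc hWi).mul_const
    ((4 * Real.pi : ℂ)⁻¹)
  have hpi : (Real.pi : ℂ) ≠ 0 := by exact_mod_cast Real.pi_ne_zero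
  have hzero := tendsto_nhds_unique (tendsto_const_nhds.congr' ?_) ((h1.add h2).add h3) (a := 0)
  · have hBval : B = -(8 * (Real.pi : ℂ)) := by
      have e3 : ∫ z : ℂ, 4 * (((‖z ^ 2 - 1‖ ^ 2 * Real.exp (ψ z) : ℝ) : ℂ) +
          (starRingEnd ℂ) (z ^ 2 - 1) * (Real.exp (ψ z) : ℂ)) = 4 * (16 * Real.pi + B) := by
        rw [integral_const_mul, integral_add hWic hIc, integral_complex_ofReal, hmass,
          ← hB, Complex.ofReal_mul, Complex.ofReal_ofNat]
      rw [hmass] at hzero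
      -- The limiting identity `2M - M²/(4π) + 4(M + B) = 0` at `M = 16π`, that is `32π - 64π + 64π
      -- + 4B = 0`.
      have hzero' : (0 : ℂ) = 2 * ((16 * Real.pi : ℝ) : ℂ) +
        -((16 * Real.pi : ℝ) : ℂ) ^ 2 * (4 * Real.pi : ℂ)⁻¹ + 4 * (16 * Real.pi + B) := by
        rw [← e3]
        exact hzero
      push_cast at hzero'
      field_simp at hzero'
      linear_combination (-1 / 16) * hzero'
    have : (starRingEnd ℂ) B = ∫ z : ℂ, (Real.exp (ψ z) : ℂ) * (z ^ 2 - 1) := by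
      rw [hB]
      simp only [hconj]
      rw [integral_conj, Complex.conj_conj]
    rw [← this, hBval, map_neg, map_mul, Complex.conj_ofReal, map_ofNat]
  · filter_upwards [Filter.eventually_gt_atTop 0] with R hR
    have h := truncated_pohozaev hψ hR
    have hrep (x : ℂ) : dz (fun z => (ψ z : ℂ)) x = (2 * Real.pi : ℂ)⁻¹ *
        ∫ y : ℂ, ((‖y ^ 2 - 1‖ ^ 2 * Real.exp (ψ y) : ℝ) : ℂ) / (y - x) := by
      rw [← dz_eq_integral hψ hWc (fun z => by positivity) hWi heq he x]
      field_simp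
    simp only [hsplit] at h
    rw [← h]
    congr 2
    rw [← integral_const_mul, ← integral_mul_const]
    refine integral_congr_ae (Filter.Eventually.of_forall fun x => ?_)
    simp only [hrep]
    rw [mul_inv, mul_inv]
    ring
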